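/- Let $H$ be a finite, simple, connected graph with vertex set $\{v_1,\dots,v_k\}$, $k\ge 2$, let $n_1,\dots,n_k\ge 1$ be integers, and let $\{v_1,\dots,v_k\}=V_e\sqcup V_f$ be a partition into two (possibly empty) sets. Let $H^B$ be the unbalanced blow-up of $H$: each $v_i\in V_e$ is replaced by the empty graph $\overline{K_{n_i}}$ and each $v_i\in V_f$ by the complete graph $K_{n_i}$, on vertices $v_{i1},\dots,v_{in_i}$, and $v_{ip}$ is joined to $v_{jq}$ for all $p,q$ whenever $v_iv_j\in E(H)$. All edges of $H^B$ have weight $1$. Let $H^{\bigtriangledown}$ be the edge-weighted graph on $H$ in which the edge $v_iv_j$ has weight $n_in_j$. For a connected graph $G$ with positive edge weights, $R_G(u,v)$ denotes the resistance distance, that is, the potential difference between $u$ and $v$ when a unit current enters at $u$ and leaves at $v$ and each edge $e$ is a resistor of conductance equal to its weight; $Kf(G)=\sum_{\{u,v\}}R_G(u,v)$, summed over the unordered pairs of distinct vertices, is the Kirchhoff index. For each $i$ put $$r_i=\frac{1}{\sum_{v_a\in N_H(v_i)}n_a},\qquad s_i=\frac{-1}{n_i\sum_{v_a\in N_H(v_i)}n_a}.$$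 Then, for $p\in\{1,\dots,n_i\}$ and $q\in\{1,\dots,n_j\}$, $$R_{H^B}(v_{ip},v_{jq})=\begin{cases} 2r_i, & v_i=v_j\in V_e,\ p\ne q;\\[2pt] \dfrac{2r_i}{n_ir_i+1}, & v_i=v_j\in V_f,\ p\neq q;\\[4pt] R_{H^{\bigtriangledown}}(v_i,v_j)+r_i+r_j+s_i+s_j, & v_i,v_j\in V_e,\ v_i\neq v_j;\\[2pt] R_{H^{\bigtriangledown}}(v_i,v_j)+\dfrac{r_i(r_i+1)}{n_ir_i+1}+\dfrac{r_j(r_j+1)}{n_jr_j+1}+s_i+s_j, & v_i,v_j\in V_f,\ v_i\neq v_j;\\[4pt] R_{H^{\bigtriangledown}}(v_i,v_j)+r_i+\dfrac{r_j(r_j+1)}{n_jr_j+1}+s_i+s_j, & v_i\in V_e,\ v_j\in V_f. \end{cases}$$ Moreover, $$\begin{aligned}Kf(H^B)={}&\sum_{v_i\in V_e}\binom{n_i}{2}2r_i+\sum_{v_i\in V_f}\binom{n_i}{2}\frac{2r_i}{n_ir_i+1} +\sum_{\substack{v_i,v_j\in V_e\\ i<j}}n_in_j\bigl(R_{H^{\bigtriangledown}}(v_i,v_j)+r_i+r_j+s_i+s_j\bigr)\\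 &+\sum_{\substack{v_i,v_j\in V_f\\ i<j}}n_in_j\Bigl(R_{H^{\bigtriangledown}}(v_i,v_j)+\frac{r_i(r_i+1)}{n_ir_i+1}+\frac{r_j(r_j+1)}{n_jr_j+1}+s_i+s_j\Bigr)\\ &+\sum_{v_i\in V_e}\sum_{v_j\in V_f}n_in_j\Bigl(R_{H^{\bigtriangledown}}(v_i,v_j)+r_i+\frac{r_j(r_j+1)}{n_jr_j+1}+s_i+s_j\Bigr).\end{aligned}$$ -/

import Mathlib

open Finset

namespace BlowUp

section Network

variable {V : Type*} [Fintype V]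

open Classical in
/-- Kirchhoff's law in the electrical network with underlying graph `G`, where an edge `e` has
conductance `ω e` (resistance `1 / ω e`): the potential `f` drives a unit current that
enters at `u` and leaves at `v`. By Ohm's law the current from `x` to a neighbour `y` is
`ω s(x, y) * (f x - f y)`. -/
def IsUnitPotential (G : SimpleGraph V) (ω : Sym2 V → ℝ) (u v : V) (f : V → ℝ) : Prop :=
  ∀ x, ∑ y ∈ univ.filter (fun y => G.Adj x y), ω s(x, y) * (f x - f y) =
    (if x = u then 1 else 0) - (if x = v then 1 else 0)

open Classical in
/-- The resistance distance between `u` and `v` in the edge-weighted graph `(G, ω)`: the potential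
difference between `u` and `v` under a unit current from `u` to `v`. It does not depend on the
chosen potential (`resistance_eq`), and a potential exists if `G` is connected and its edge weights
are positive (`exists_isUnitPotential`); without any potential the value is set to `0`. -/
noncomputable def resistance (G : SimpleGraph V) (ω : Sym2 V → ℝ) (u v : V) : ℝ :=
  if h : ∃ f, IsUnitPotential G ω u v f then h.choose u - h.choose v else 0

/-- The edge weights of a graph all of whose edges have weight `1`. -/
def unitWeight : Sym2 V → ℝ := fun _ => 1

/-- The edge weights induced by a vertex weight `w`: the edge `ab` gets the weight `w a * w b`. -/
def vertexWeight (w : V → ℝ) : Sym2 V → ℝ :=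
  Sym2.lift ⟨fun a b => w a * w b, fun a b => mul_comm (w a) (w b)⟩

/-- The Kirchhoff index of a graph: the sum of the resistance distances over all unordered pairs
of vertices (a vertex has resistance distance `0` to itself). -/
noncomputable def kirchhoffIndex (G : SimpleGraph V) : ℝ :=
  (1 / 2) * ∑ u, ∑ v, resistance G unitWeight u v

open Classical in
/-- Green's identity for the weighted Laplacian. -/
theorem sum_green (G : SimpleGraph V) (ω : Sym2 V → ℝ) (f g : V → ℝ) :
    ∑ x, g x * ∑ y ∈ univ.filter (fun y => G.Adj x y), ω s(x, y) * (f x - f y) =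
      (1 / 2) * ∑ x, ∑ y ∈ univ.filter (fun y => G.Adj x y),
        ω s(x, y) * ((f x - f y) * (g x - g y)) := by
  have h1 : ∑ x, g x * ∑ y ∈ univ.filter (fun y => G.Adj x y), ω s(x, y) * (f x - f y) =
      ∑ x, ∑ y, if G.Adj x y then ω s(x, y) * (f x - f y) * g x else 0 := by
    refine sum_congr rfl fun x _ => ?_
    rw [sum_filter, mul_sum]
    refine sum_congr rfl fun y _ => ?_
    split_ifs <;> ring
  have h2 : ∑ x, ∑ y, (if G.Adj x y then ω s(x, y) * (f x - f y) * g x else 0) =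
      ∑ x, ∑ y, if G.Adj x y then ω s(x, y) * (f y - f x) * g y else 0 := by
    rw [sum_comm]
    refine sum_congr rfl fun x _ => sum_congr rfl fun y _ => ?_
    rw [G.adj_comm y x, Sym2.eq_swap]
  have h3 : ∑ x, ∑ y ∈ univ.filter (fun y => G.Adj x y),
        ω s(x, y) * ((f x - f y) * (g x - g y)) =
      ∑ x, ∑ y, (if G.Adj x y then ω s(x, y) * (f x - f y) * g x else 0) +
      ∑ x, ∑ y, (if G.Adj x y then ω s(x, y) * (f y - f x) * g y else 0) := by
    rw [← sum_add_distrib]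
    refine sum_congr rfl fun x _ => ?_
    rw [sum_filter, ← sum_add_distrib]
    refine sum_congr rfl fun y _ => ?_
    split_ifs <;> ring
  rw [h3, ← h2, h1]
  ring

/-- All unit potentials from `u` to `v` have the same potential difference. -/
theorem resistance_eq {G : SimpleGraph V} {ω : Sym2 V → ℝ} {u v : V} {f : V → ℝ}
    (hf : IsUnitPotential G ω u v f) : resistance G ω u v = f u - f v := by
  classical
  have h : ∃ f, IsUnitPotential G ω u v f := ⟨f, hf⟩
  have key : ∀ a b : V → ℝ, IsUnitPotential G ω u v a →
      (1 / 2) * ∑ x, ∑ y ∈ univ.filter (fun y => G.Adj x y),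
        ω s(x, y) * ((a x - a y) * (b x - b y)) = b u - b v := by
    intro a b ha
    rw [← sum_green]
    calc _ = ∑ x, b x * ((if x = u then 1 else 0) - (if x = v then 1 else 0)) :=
          sum_congr rfl fun x _ => congrArg (b x * ·) (by convert ha x)
      _ = _ := by simp [mul_sub, sum_sub_distrib]
  rw [resistance, dif_pos h, ← key f _ hf, ← key _ f h.choose_spec]
  simp only [mul_comm (f _ - f _)]

/-- In a connected network with positive conductances unit potentials exist. -/
theorem exists_isUnitPotential {G : SimpleGraph V} (hG : G.Connected) {ω : Sym2 V → ℝ}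
    (hω : ∀ e ∈ G.edgeSet, 0 < ω e) (u v : V) : ∃ f, IsUnitPotential G ω u v f := by
  classical
  have : Nonempty V := ⟨u⟩
  let L : (V → ℝ) →ₗ[ℝ] (V → ℝ) :=
    { toFun := fun f x =>
        ∑ y ∈ univ.filter (fun y => G.Adj x y), ω s(x, y) * (f x - f y) + ∑ z, f z
      map_add' := by
        intro f g
        funext x
        simp only [Pi.add_apply, sum_add_distrib, add_sub_add_comm, mul_add]
        ring
      map_smul' := by
        intro c f
        funext x
        simp only [Pi.smul_apply, smul_eq_mul, RingHom.id_apply, mul_add, mul_sum]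
        congr 1
        exact sum_congr rfl fun y _ => by ring }
  have hL : ∀ f x, L f x =
      ∑ y ∈ univ.filter (fun y => G.Adj x y), ω s(x, y) * (f x - f y) + ∑ z, f z :=
    fun _ _ => rfl
  have hsum : ∀ f, ∑ x, L f x = 0 → ∑ z, f z = 0 := by
    intro f h
    have h0 := sum_green G ω f (fun _ => 1)
    simp only [sub_self, mul_zero, sum_const_zero, one_mul] at h0
    simp only [hL, sum_add_distrib, h0, sum_const, nsmul_eq_mul, zero_add] at h
    rcases mul_eq_zero.1 h with h | h
    · simp at h
    · exact h
  have hinj : Function.Injective L := by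
    rw [injective_iff_map_eq_zero]
    intro f h
    have hs : ∑ z, f z = 0 := hsum f (by simp [h])
    have h0 := sum_green G ω f f
    have hx : ∀ x, ∑ y ∈ univ.filter (fun y => G.Adj x y), ω s(x, y) * (f x - f y) = 0 := by
      intro x
      have := congrFun h x
      rw [hL, hs, add_zero] at this
      simpa using this
    simp only [hx, mul_zero, sum_const_zero] at h0
    have hnn : ∀ x, ∀ y ∈ univ.filter (fun y => G.Adj x y),
        0 ≤ ω s(x, y) * ((f x - f y) * (f x - f y)) := fun x y hy =>
      mul_nonneg (hω _ (by simpa using hy)).le (mul_self_nonneg _)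
    have h1 : ∑ x, ∑ y ∈ univ.filter (fun y => G.Adj x y),
        ω s(x, y) * ((f x - f y) * (f x - f y)) = 0 := by linarith
    rw [sum_eq_zero_iff_of_nonneg (fun x _ => sum_nonneg (hnn x))] at h1
    have hadj : ∀ x y, G.Adj x y → f x = f y := by
      intro x y hxy
      have h2 := (sum_eq_zero_iff_of_nonneg (hnn x)).1 (h1 x (mem_univ x)) y (by simpa using hxy)
      rcases mul_eq_zero.1 h2 with h3 | h3
      · exact absurd h3 (hω _ (by simpa using hxy)).ne'
      · exact sub_eq_zero.1 (mul_self_eq_zero.1 h3)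
    have hconst : ∀ x y, f x = f y := by
      intro x y
      obtain ⟨p⟩ := hG.preconnected x y
      induction p with
      | nil => rfl
      | cons hxy _ ih => exact (hadj _ _ hxy).trans ih
    funext x
    have : ∑ z, f z = ∑ _z : V, f x := sum_congr rfl fun z _ => hconst z x
    rw [hs, sum_const, nsmul_eq_mul] at this
    rcases mul_eq_zero.1 this.symm with h | h
    · simp at h
    · exact h
  obtain ⟨f, hf⟩ := (LinearMap.injective_iff_surjective.1 hinj)
    (fun x => (if x = u then 1 else 0) - (if x = v then 1 else 0))
  have hs : ∑ z, f z = 0 := hsum f (by rw [hf]; simp [sum_sub_distrib])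
  refine ⟨f, fun x => ?_⟩
  have := congrFun hf x
  rw [hL, hs, add_zero] at this
  convert this

/-- The resistance distance is symmetric. -/
theorem resistance_comm (G : SimpleGraph V) (ω : Sym2 V → ℝ) (u v : V) :
    resistance G ω u v = resistance G ω v u := by
  have key : ∀ a b (f : V → ℝ), IsUnitPotential G ω a b f → IsUnitPotential G ω b a (-f) := by
    intro a b f hf x
    have := hf x
    rw [← neg_sub, ← this, ← sum_neg_distrib]
    refine sum_congr rfl fun y _ => ?_
    simp only [Pi.neg_apply]
    ring
  by_cases h : ∃ f, IsUnitPotential G ω u v f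
  · obtain ⟨f, hf⟩ := h
    rw [resistance_eq hf, resistance_eq (key _ _ _ hf)]
    simp only [Pi.neg_apply]
    ring
  · have h' : ¬ ∃ f, IsUnitPotential G ω v u f := fun ⟨f, hf⟩ => h ⟨_, key _ _ _ hf⟩
    rw [resistance, resistance, dif_neg h, dif_neg h']

end Network

/-- The generalized join: every vertex `i` of `H` is replaced by the graph `G i`, and every
vertex of `G i` is joined to every vertex of `G j` whenever `i` and `j` are adjacent in `H`. -/
def generalizedJoin {V : Type*} (H : SimpleGraph V) {W : V → Type*}
    (G : ∀ i, SimpleGraph (W i)) : SimpleGraph (Σ i, W i) where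
  Adj x y := H.Adj x.1 y.1 ∨ ∃ (i : V) (a b : W i), x = ⟨i, a⟩ ∧ y = ⟨i, b⟩ ∧ (G i).Adj a b
  symm := ⟨by
    rintro x y (h | ⟨i, a, b, hx, hy, h⟩)
    · exact Or.inl h.symm
    · exact Or.inr ⟨i, b, a, hy, hx, h.symm⟩⟩
  loopless := ⟨by
    rintro x (h | ⟨i, a, b, rfl, hy, h⟩)
    · exact h.ne rfl
    · obtain rfl : a = b := by simpa using hy
      exact h.ne rfl⟩

/-- The unbalanced blow-up of `H`: the vertex `i` is replaced by the complete graph on `n i`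
vertices if `i ∈ Vf`, and by the empty graph on `n i` vertices otherwise. -/
def unbalancedBlowUp {k : ℕ} (H : SimpleGraph (Fin k)) (n : Fin k → ℕ) (Vf : Finset (Fin k)) :
    SimpleGraph (Σ i, Fin (n i)) :=
  generalizedJoin H fun i => if i ∈ Vf then (⊤ : SimpleGraph (Fin (n i))) else ⊥

/-- The resistance distance in the unbalanced blow-up, all of whose edges have weight `1`. -/
noncomputable def blowUpResistance {k : ℕ} (H : SimpleGraph (Fin k)) (n : Fin k → ℕ)
    (Vf : Finset (Fin k)) (x y : Σ i, Fin (n i)) : ℝ :=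
  resistance (unbalancedBlowUp H n Vf) unitWeight x y

/-- The resistance distance in the graph `H` with vertex weights `n i`. -/
noncomputable def nablaResistance {k : ℕ} (H : SimpleGraph (Fin k)) (n : Fin k → ℕ)
    (i j : Fin k) : ℝ :=
  resistance H (vertexWeight fun a => (n a : ℝ)) i j

open Classical in
/-- The sum of the `n a` over all neighbours `a` of `i` in `H`. -/
noncomputable def nbrSum {k : ℕ} (H : SimpleGraph (Fin k)) (n : Fin k → ℕ) (i : Fin k) : ℝ :=
  ∑ a ∈ univ.filter (fun a => H.Adj i a), (n a : ℝ)

end BlowUp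

/-!
Over a vertex `a` of `H`, a function on the blow-up splits into its mean and a deviation whose sum
over the fibre vanishes, and the Laplacian of the blow-up respects this splitting
(`laplacian_blowUp`). On functions that are constant on fibres it is the Laplacian of the network
with edge weights `n i * n j`, divided by the fibre size; on deviations it is multiplication by
`d a` for an empty fibre and by `d a + n a` for a complete one, where `d a = nbrSum H n a`.

A unit source at a vertex `u` in the fibre of `i` is the constant `1 / n i` on the fibre plus the
deviation `δ_u - 1 / n i`. Hence a unit potential of the blow-up is obtained from one of the
weighted network on `H` by adding, at each terminal, this deviation times
`c i = 1 / (d i + [i ∈ Vf] n i)` (`isUnitPotential_blowUp`). Reading off the potential differences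
gives `R = 2 c i` inside a fibre and `R = R_∇ + (1 - 1 / n i) c i + (1 - 1 / n j) c j` between two
fibres. The Kirchhoff index is the sum of these values over pairs of fibres.
-/

namespace BlowUp

/-! ### Potentials on the blow-up -/

section Potential

variable {k : ℕ} {H : SimpleGraph (Fin k)} {n : Fin k → ℕ} {Vf : Finset (Fin k)}

theorem unbalancedBlowUp_adj (x y : Σ i, Fin (n i)) :
    (unbalancedBlowUp H n Vf).Adj x y ↔
      H.Adj x.1 y.1 ∨ (y.1 = x.1 ∧ x.1 ∈ Vf ∧ x ≠ y) := by
  simp only [unbalancedBlowUp, generalizedJoin]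
  refine or_congr Iff.rfl ⟨?_, ?_⟩
  · rintro ⟨i, a, b, rfl, rfl, h⟩
    by_cases hi : i ∈ Vf
    · simp only [hi, if_true, SimpleGraph.top_adj] at h
      exact ⟨rfl, hi, by simpa using h⟩
    · simp [hi] at h
  · obtain ⟨i, a⟩ := x
    obtain ⟨j, b⟩ := y
    rintro ⟨h, hi, hne⟩
    dsimp only at h hi
    subst h
    exact ⟨j, a, b, rfl, rfl, by simpa [hi] using hne⟩

variable (H n Vf) in
/-- The inverse of the eigenvalue of the Laplacian of the blow-up on the functions that are
supported on the fibre of `i` and have sum `0`. -/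
noncomputable def fibreConst (i : Fin k) : ℝ :=
  1 / (nbrSum H n i + if i ∈ Vf then (n i : ℝ) else 0)

variable (H n Vf) in
/-- The potential generated by a unit source at `u` together with a sink spread evenly over the
fibre that contains `u`. -/
noncomputable def fibrePotential (u x : Σ i, Fin (n i)) : ℝ :=
  if x.1 = u.1 then fibreConst H n Vf u.1 * ((if x = u then 1 else 0) - 1 / n u.1) else 0

theorem sum_fibrePotential (u : Σ i, Fin (n i)) (a : Fin k) :
    ∑ b, fibrePotential H n Vf u ⟨a, b⟩ = 0 := by
  obtain ⟨i, p⟩ := u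
  simp only [fibrePotential]
  split_ifs with h
  · subst h
    have : (n a : ℝ) ≠ 0 := by
      have := p.pos
      positivity
    simp [← mul_sum, sum_sub_distrib, this]
  · simp

open Classical in
/-- The Laplacian of the blow-up, evaluated on a function that is constant on fibres plus a
function whose sum over each fibre is `0`. -/
theorem laplacian_blowUp (f : Fin k → ℝ) (g : (Σ i, Fin (n i)) → ℝ)
    (hg : ∀ a, ∑ b, g ⟨a, b⟩ = 0) (x : Σ i, Fin (n i)) :
    ∑ y ∈ univ.filter (fun y => (unbalancedBlowUp H n Vf).Adj x y),
        unitWeight s(x, y) * ((f x.1 + g x) - (f y.1 + g y)) =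
      ∑ a ∈ univ.filter (fun a => H.Adj x.1 a), (n a : ℝ) * (f x.1 - f a) +
        (nbrSum H n x.1 + if x.1 ∈ Vf then (n x.1 : ℝ) else 0) * g x := by
  -- The loop `y = x` may be added to the second sum, since its summand vanishes.
  have h1 : ∀ y : Σ i, Fin (n i),
      (if (unbalancedBlowUp H n Vf).Adj x y then
        unitWeight s(x, y) * ((f x.1 + g x) - (f y.1 + g y)) else 0) =
      (if H.Adj x.1 y.1 then (f x.1 - f y.1) + g x - g y else 0) +
      (if y.1 = x.1 then (if x.1 ∈ Vf then g x - g y else 0) else 0) := by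
    intro y
    rw [unbalancedBlowUp_adj]
    by_cases hH : H.Adj x.1 y.1
    · have : y.1 ≠ x.1 := hH.ne'
      simp only [hH, this, unitWeight, true_or, if_true, if_false]
      ring
    · by_cases hy : y.1 = x.1
      · by_cases hxy : x = y
        · subst hxy
          simp
        · by_cases hx : x.1 ∈ Vf <;> simp [hy, hxy, hx, unitWeight]
      · simp [hH, hy]
  have h2 : ∀ a, ∑ b : Fin (n a),
      (if H.Adj x.1 a then (f x.1 - f a) + g x - g ⟨a, b⟩ else 0) =
      if H.Adj x.1 a then (n a : ℝ) * (f x.1 - f a) + n a * g x else 0 := by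
    intro a
    split_ifs
    · simp [sum_sub_distrib, hg]
    · simp
  have h3 : ∀ a, ∑ b : Fin (n a),
      (if a = x.1 then (if x.1 ∈ Vf then g x - g ⟨a, b⟩ else 0) else 0) =
      if a = x.1 then (if x.1 ∈ Vf then (n a : ℝ) * g x else 0) else 0 := by
    intro a
    split_ifs
    · simp [sum_sub_distrib, hg]
    · simp
    · simp
  rw [sum_filter, sum_congr rfl fun y _ => h1 y, sum_add_distrib, Fintype.sum_sigma,
    Fintype.sum_sigma]
  dsimp only
  rw [sum_congr rfl fun a _ => h2 a, sum_congr rfl fun a _ => h3 a, ← sum_filter,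
    sum_add_distrib, ← sum_mul, nbrSum, sum_ite_eq' univ x.1, if_pos (mem_univ _)]
  split_ifs <;> ring

theorem nbrSum_pos (hk : 2 ≤ k) (hH : H.Connected) (hn : ∀ i, 1 ≤ n i) (i : Fin k) :
    0 < nbrSum H n i := by
  classical
  have : Nontrivial (Fin k) := Fin.nontrivial_iff_two_le.2 hk
  obtain ⟨j, hj⟩ := hH.preconnected.exists_adj_of_nontrivial i
  have hpos : ∀ a, (0 : ℝ) < n a := fun a => by exact_mod_cast hn a
  exact sum_pos (fun a _ => hpos a) ⟨j, by simpa using hj⟩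

/-- A unit potential of the weighted network on `H` lifts to one of the blow-up: the fibre potentials
concentrate the current, spread evenly over the fibres of the terminals, at the terminals. -/
theorem isUnitPotential_blowUp (hd : ∀ i, 0 < nbrSum H n i) (hn : ∀ i, 1 ≤ n i)
    {u v : Σ i, Fin (n i)} {f : Fin k → ℝ}
    (hf : IsUnitPotential H (vertexWeight fun a => (n a : ℝ)) u.1 v.1 f) :
    IsUnitPotential (unbalancedBlowUp H n Vf) unitWeight u v fun x =>
      f x.1 + (fibrePotential H n Vf u x - fibrePotential H n Vf v x) := by
  classical
  intro x
  have hx : (0 : ℝ) < n x.1 := by exact_mod_cast hn x.1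
  have hf' : ∑ a ∈ univ.filter (fun a => H.Adj x.1 a), (n a : ℝ) * (f x.1 - f a) =
      ((if x.1 = u.1 then 1 else 0) - (if x.1 = v.1 then 1 else 0)) / n x.1 := by
    rw [eq_div_iff hx.ne', sum_mul]
    convert hf x.1 using 1
    · refine sum_congr (by congr) fun a _ => ?_
      simp only [vertexWeight, Sym2.lift_mk]
      ring
    · split_ifs <;> rfl
  have hc : ∀ w : Σ i, Fin (n i),
      (nbrSum H n x.1 + if x.1 ∈ Vf then (n x.1 : ℝ) else 0) * fibrePotential H n Vf w x =
      (if x = w then 1 else 0) - (if x.1 = w.1 then 1 else 0) / n x.1 := by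
    intro w
    have hD : nbrSum H n x.1 + (if x.1 ∈ Vf then (n x.1 : ℝ) else 0) ≠ 0 := by
      have := hd x.1
      split_ifs <;> positivity
    by_cases h : x.1 = w.1
    · simp only [fibrePotential, fibreConst, ← h, if_true]
      rw [← mul_assoc, mul_one_div_cancel hD, one_mul]
    · have : x ≠ w := fun h' => h (by rw [h'])
      simp [fibrePotential, h, this]
  have := laplacian_blowUp (H := H) (Vf := Vf) f
    (fun x => fibrePotential H n Vf u x - fibrePotential H n Vf v x)
    (fun a => by simp [sum_sub_distrib, sum_fibrePotential]) x
  rw [hf', mul_sub, hc, hc] at this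
  convert this using 1
  trans (if x = u then 1 else 0) - (if x = v then 1 else 0)
  · congr!
  · ring

/-! ### Resistance distances -/

theorem resistance_self {V : Type*} [Fintype V] (G : SimpleGraph V) (ω : Sym2 V → ℝ) (u : V) :
    resistance G ω u u = 0 := by
  rw [resistance]
  split_ifs <;> simp

/-- This covers terminals in the same fibre too: the resistance distance in `H` is then `0`. -/
theorem blowUpResistance_eq (hH : H.Connected) (hd : ∀ i, 0 < nbrSum H n i)
    (hn : ∀ i, 1 ≤ n i) (u v : Σ i, Fin (n i)) :
    blowUpResistance H n Vf u v = nablaResistance H n u.1 v.1 +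
      (fibrePotential H n Vf u u - fibrePotential H n Vf v u) -
      (fibrePotential H n Vf u v - fibrePotential H n Vf v v) := by
  have hω : ∀ e ∈ H.edgeSet, 0 < vertexWeight (fun a => (n a : ℝ)) e := by
    intro e _
    induction e with
    | h a b =>
      have ha := hn a
      have hb := hn b
      simp only [vertexWeight, Sym2.lift_mk]
      positivity
  obtain ⟨f, hf⟩ := exists_isUnitPotential hH hω u.1 v.1
  rw [blowUpResistance, nablaResistance, resistance_eq hf,
    resistance_eq (isUnitPotential_blowUp hd hn hf)]
  ring

theorem blowUpResistance_same_fibre (hH : H.Connected) (hd : ∀ i, 0 < nbrSum H n i)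
    (hn : ∀ i, 1 ≤ n i) (i : Fin k) {p q : Fin (n i)} (hpq : p ≠ q) :
    blowUpResistance H n Vf ⟨i, p⟩ ⟨i, q⟩ = 2 * fibreConst H n Vf i := by
  rw [blowUpResistance_eq hH hd hn, nablaResistance, resistance_self]
  simp only [fibrePotential, if_true, Sigma.mk.injEq, heq_eq_eq, true_and, hpq, hpq.symm, if_false]
  ring

theorem blowUpResistance_of_ne (hH : H.Connected) (hd : ∀ i, 0 < nbrSum H n i)
    (hn : ∀ i, 1 ≤ n i) {i j : Fin k} (hij : i ≠ j) (p : Fin (n i)) (q : Fin (n j)) :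
    blowUpResistance H n Vf ⟨i, p⟩ ⟨j, q⟩ = nablaResistance H n i j +
      fibreConst H n Vf i * (1 - 1 / n i) + fibreConst H n Vf j * (1 - 1 / n j) := by
  rw [blowUpResistance_eq hH hd hn]
  simp only [fibrePotential, if_true, hij, hij.symm, if_false]
  ring

end Potential

/-! ### The Kirchhoff index -/

section Sums

variable {k : ℕ}

/-- Half the sum of a symmetric function over all ordered pairs splits, along a partition into two
parts, into the diagonal, the unordered pairs inside each part, and the mixed pairs. -/
theorem half_sum_of_isCompl {A B : Finset (Fin k)} (hAB : IsCompl A B) (T : Fin k → Fin k → ℝ)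
    (hT : ∀ i j, T i j = T j i) :
    (1 / 2) * ∑ i, ∑ j, T i j =
      ∑ i ∈ A, T i i / 2 + ∑ i ∈ B, T i i / 2 + ∑ i ∈ A, ∑ j ∈ A with i < j, T i j +
        ∑ i ∈ B, ∑ j ∈ B with i < j, T i j + ∑ i ∈ A, ∑ j ∈ B, T i j := by
  have hsplit : ∀ g : Fin k → ℝ, ∑ i, g i = ∑ i ∈ A, g i + ∑ i ∈ B, g i := by
    intro g
    rw [← sum_union hAB.disjoint]
    congr 1
    exact (hAB.sup_eq_top).symm
  have hpart : ∀ C : Finset (Fin k), ∑ i ∈ C, ∑ j ∈ C, T i j =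
      2 * ∑ i ∈ C, ∑ j ∈ C with i < j, T i j + ∑ i ∈ C, T i i := by
    intro C
    have h1 : ∑ i ∈ C, ∑ j ∈ C with i < j, T i j = ∑ i ∈ C, ∑ j ∈ C with j < i, T i j := by
      simp only [sum_filter]
      rw [sum_comm]
      simp only [hT]
    have h2 : ∑ i ∈ C, T i i = ∑ i ∈ C, ∑ j ∈ C with i = j, T i j := by
      refine sum_congr rfl fun i hi => ?_
      rw [sum_filter, sum_ite_eq, if_pos hi]
    rw [two_mul]
    nth_rewrite 2 [h1]
    rw [h2, ← sum_add_distrib, ← sum_add_distrib]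
    refine sum_congr rfl fun i _ => ?_
    simp only [sum_filter]
    rw [← sum_add_distrib, ← sum_add_distrib]
    refine sum_congr rfl fun j _ => ?_
    rcases lt_trichotomy i j with h | h | h
    · simp [h, h.ne, h.not_gt]
    · simp [h]
    · simp [h, h.ne', h.not_gt]
  have hmix : ∑ i ∈ B, ∑ j ∈ A, T i j = ∑ i ∈ A, ∑ j ∈ B, T i j := by
    rw [sum_comm]
    exact sum_congr rfl fun i _ => sum_congr rfl fun j _ => hT j i
  rw [hsplit]
  simp only [fun i => hsplit (T i), sum_add_distrib]
  rw [hpart A, hpart B, hmix, ← sum_div, ← sum_div]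
  ring

variable {H : SimpleGraph (Fin k)} {n : Fin k → ℕ} {Vf : Finset (Fin k)}

theorem sum_blowUpResistance_same_fibre (hH : H.Connected) (hd : ∀ i, 0 < nbrSum H n i)
    (hn : ∀ i, 1 ≤ n i) (i : Fin k) :
    (∑ p, ∑ q, blowUpResistance H n Vf ⟨i, p⟩ ⟨i, q⟩) / 2 =
      ((n i).choose 2 : ℝ) * (2 * fibreConst H n Vf i) := by
  have h : ∀ p q, blowUpResistance H n Vf ⟨i, p⟩ ⟨i, q⟩ =
      2 * fibreConst H n Vf i - if p = q then 2 * fibreConst H n Vf i else 0 := by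
    intro p q
    split_ifs with hpq
    · rw [hpq, blowUpResistance, resistance_self, sub_self]
    · rw [blowUpResistance_same_fibre hH hd hn i hpq, sub_zero]
  simp only [h, sum_sub_distrib, sum_ite_eq, mem_univ, if_true, sum_const, card_univ,
    Fintype.card_fin, nsmul_eq_mul, Nat.cast_choose_two]
  ring

end Sums

end BlowUp

open BlowUp in
theorem corollaryc37 (k : ℕ) (hk : 2 ≤ k) (H : SimpleGraph (Fin k)) (hH : H.Connected)
    (n : Fin k → ℕ) (hn : ∀ i, 1 ≤ n i) (Ve Vf : Finset (Fin k)) (hV : IsCompl Ve Vf)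
    (r s : Fin k → ℝ) (hr : ∀ i, r i = 1 / nbrSum H n i)
    (hs : ∀ i, s i = -1 / ((n i : ℝ) * nbrSum H n i)) :
    (∀ i ∈ Ve, ∀ p q : Fin (n i), p ≠ q →
      blowUpResistance H n Vf ⟨i, p⟩ ⟨i, q⟩ = 2 * r i) ∧
    (∀ i ∈ Vf, ∀ p q : Fin (n i), p ≠ q →
      blowUpResistance H n Vf ⟨i, p⟩ ⟨i, q⟩ = 2 * r i / (n i * r i + 1)) ∧
    (∀ i ∈ Ve, ∀ j ∈ Ve, i ≠ j → ∀ (p : Fin (n i)) (q : Fin (n j)),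
      blowUpResistance H n Vf ⟨i, p⟩ ⟨j, q⟩ =
        nablaResistance H n i j + r i + r j + s i + s j) ∧
    (∀ i ∈ Vf, ∀ j ∈ Vf, i ≠ j → ∀ (p : Fin (n i)) (q : Fin (n j)),
      blowUpResistance H n Vf ⟨i, p⟩ ⟨j, q⟩ =
        nablaResistance H n i j + r i * (r i + 1) / (n i * r i + 1)
          + r j * (r j + 1) / (n j * r j + 1) + s i + s j) ∧
    (∀ i ∈ Ve, ∀ j ∈ Vf, ∀ (p : Fin (n i)) (q : Fin (n j)),
      blowUpResistance H n Vf ⟨i, p⟩ ⟨j, q⟩ =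
        nablaResistance H n i j + r i + r j * (r j + 1) / (n j * r j + 1) + s i + s j) ∧
    kirchhoffIndex (unbalancedBlowUp H n Vf) =
      ∑ i ∈ Ve, ((n i).choose 2 : ℝ) * (2 * r i)
      + ∑ i ∈ Vf, ((n i).choose 2 : ℝ) * (2 * r i / (n i * r i + 1))
      + ∑ i ∈ Ve, ∑ j ∈ Ve with i < j, (n i : ℝ) * n j *
          (nablaResistance H n i j + r i + r j + s i + s j)
      + ∑ i ∈ Vf, ∑ j ∈ Vf with i < j, (n i : ℝ) * n j *
          (nablaResistance H n i j + r i * (r i + 1) / (n i * r i + 1)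
            + r j * (r j + 1) / (n j * r j + 1) + s i + s j)
      + ∑ i ∈ Ve, ∑ j ∈ Vf, (n i : ℝ) * n j *
          (nablaResistance H n i j + r i + r j * (r j + 1) / (n j * r j + 1) + s i + s j) := by
  have hd := nbrSum_pos hk hH hn
  have hN : ∀ i, (n i : ℝ) ≠ 0 := fun i => by
    have := hn i
    positivity
  have hmem : ∀ i ∈ Ve, i ∉ Vf := fun i hi hi' => disjoint_left.1 hV.disjoint hi hi'
  have hce : ∀ i ∈ Ve, fibreConst H n Vf i = r i := fun i hi => by
    rw [fibreConst, if_neg (hmem i hi), add_zero, hr]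
  have hcf : ∀ i ∈ Vf, fibreConst H n Vf i = r i / (n i * r i + 1) := fun i hi => by
    have := hd i
    rw [fibreConst, if_pos hi, hr]
    field_simp
    ring
  have hee : ∀ i ∈ Ve, fibreConst H n Vf i * (1 - 1 / n i) = r i + s i := fun i hi => by
    have := (hd i).ne'
    rw [hce i hi, hr, hs]
    field_simp [hN i]
    ring
  have hef : ∀ i ∈ Vf, fibreConst H n Vf i * (1 - 1 / n i) =
      r i * (r i + 1) / (n i * r i + 1) + s i := fun i hi => by
    have := hd i
    have hNi := hN i
    rw [hcf i hi, hr, hs]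
    field_simp
    ring
  have R := fun i j (hij : i ≠ j) => blowUpResistance_of_ne (Vf := Vf) hH hd hn hij
  have hee' : ∀ i ∈ Ve, ∀ j ∈ Ve, i ≠ j → ∀ (p : Fin (n i)) (q : Fin (n j)),
      blowUpResistance H n Vf ⟨i, p⟩ ⟨j, q⟩ =
        nablaResistance H n i j + r i + r j + s i + s j := by
    intro i hi j hj hij p q
    rw [R i j hij, hee i hi, hee j hj]
    ring
  have hff' : ∀ i ∈ Vf, ∀ j ∈ Vf, i ≠ j → ∀ (p : Fin (n i)) (q : Fin (n j)),
      blowUpResistance H n Vf ⟨i, p⟩ ⟨j, q⟩ =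
        nablaResistance H n i j + r i * (r i + 1) / (n i * r i + 1)
          + r j * (r j + 1) / (n j * r j + 1) + s i + s j := by
    intro i hi j hj hij p q
    rw [R i j hij, hef i hi, hef j hj]
    ring
  have hef' : ∀ i ∈ Ve, ∀ j ∈ Vf, ∀ (p : Fin (n i)) (q : Fin (n j)),
      blowUpResistance H n Vf ⟨i, p⟩ ⟨j, q⟩ =
        nablaResistance H n i j + r i + r j * (r j + 1) / (n j * r j + 1) + s i + s j := by
    intro i hi j hj p q
    rw [R i j fun h => hmem i hi (h ▸ hj), hee i hi, hef j hj]
    ring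
  refine ⟨fun i hi p q hpq => ?_, fun i hi p q hpq => ?_, hee', hff', hef', ?_⟩
  · rw [blowUpResistance_same_fibre hH hd hn i hpq, hce i hi]
  · rw [blowUpResistance_same_fibre hH hd hn i hpq, hcf i hi, mul_div_assoc]
  · have hT := half_sum_of_isCompl hV
      (fun i j => ∑ p : Fin (n i), ∑ q : Fin (n j), blowUpResistance H n Vf ⟨i, p⟩ ⟨j, q⟩)
      (fun i j => by
        rw [sum_comm]
        exact sum_congr rfl fun q _ => sum_congr rfl fun p _ => resistance_comm _ _ _ _)
    have hK : kirchhoffIndex (unbalancedBlowUp H n Vf) = (1 / 2) * ∑ i, ∑ j,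
        ∑ p : Fin (n i), ∑ q : Fin (n j), blowUpResistance H n Vf ⟨i, p⟩ ⟨j, q⟩ := by
      simp only [kirchhoffIndex, Fintype.sum_sigma, blowUpResistance]
      congr 1
      exact sum_congr rfl fun i _ => sum_comm
    rw [hK, hT]
    congr 1
    · congr 1
      · congr 1
        · congr 1
          · refine sum_congr rfl fun i hi => ?_
            rw [sum_blowUpResistance_same_fibre hH hd hn, hce i hi]
          · refine sum_congr rfl fun i hi => ?_
            rw [sum_blowUpResistance_same_fibre hH hd hn, hcf i hi, mul_div_assoc]
        · refine sum_congr rfl fun i hi => sum_congr rfl fun j hj => ?_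
          obtain ⟨hj, hij⟩ := mem_filter.1 hj
          simp only [hee' i hi j hj hij.ne, sum_const, card_univ, Fintype.card_fin, nsmul_eq_mul, mul_assoc]
      · refine sum_congr rfl fun i hi => sum_congr rfl fun j hj => ?_
        obtain ⟨hj, hij⟩ := mem_filter.1 hj
        simp only [hff' i hi j hj hij.ne, sum_const, card_univ, Fintype.card_fin, nsmul_eq_mul, mul_assoc]
    · refine sum_congr rfl fun i hi => sum_congr rfl fun j hj => ?_
      simp only [hef' i hi j hj, sum_const, card_univ, Fintype.card_fin, nsmul_eq_mul, mul_assoc]
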